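/- Let $X$ be a nonempty compact metric space, $\varphi:[0,\infty)\times X\to X$ a continuous semiflow, $D\subset X$ a compact set and $I:D\to X$ a continuous map. Put $\tau_1(x)=\inf\{t>0:\varphi_t(x)\in D\}\in[0,\infty]$ (with $\inf\emptyset=\infty$) and assume $\tau_1(x)>0$ for all $x\in X$. The impulsive trajectory of $x\in X$ is defined as follows. Put $t_0=0$ and $x_0=x$. As long as $t_n<\infty$, put $t_{n+1}=t_n+\tau_1(x_n)$ and $\gamma_x(t)=\varphi_{t-t_n}(x_n)$ for $t_n\le t<t_{n+1}$; if moreover $t_{n+1}<\infty$, put $x_{n+1}=I(\varphi_{\tau_1(x_n)}(x_n))$. Assume that for every $x\in X$ the trajectory is defined for all times, that is, either $t_n=\infty$ for some $n$ or $\sup_n t_n=\infty$. Then $(X,\varphi,D,I)$ is called an impulsive dynamical system, and $\phi_t(x)=\gamma_x(t)$ $(t\ge 0)$ is its (not necessarily continuous) semiflow. Let $\Omega_\phi$ be the non-wandering set of $\phi$: the set of $x\in X$ such that for every neighborhood $U$ of $x$ and every $T>0$ there is $t\ge T$ with $\phi_t^{-1}(U)\cap U\ne\emptyset$. Define $\tau_D:\Omega_\phi\to[0,\infty]$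 by $\tau_D(x)=\tau_1(x)$ if $x\in\Omega_\phi\setminus D$ and $\tau_D(x)=0$ if $x\in\Omega_\phi\cap D$, where $[0,\infty]$ carries the topology of the one-point compactification of $[0,\infty)$. A Borel probability measure $\mu$ on $X$ is called $\phi$-invariant if $\phi:[0,\infty)\times X\to X$ is Borel measurable and $\mu(\phi_t^{-1}(A))=\mu(A)$ for every Borel set $A\subset X$ and every $t\ge0$. The support of $\mu$ is the set of points all of whose neighborhoods have positive measure. **Theorem.** If $\tau_D$ is continuous and $I(\Omega_\phi\cap D)\subset\Omega_\phi\setminus D$, then there is a $\phi$-invariant Borel probability measure on $X$. Moreover, every $\phi$-invariant Borel probability measure $\mu$ has its support contained in $\Omega_\phi$ and satisfies $\mu(D)=0$. -/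

import Mathlib

open MeasureTheory Set Topology
open scoped NNReal ENNReal

noncomputable section

namespace Impulsive

/-- The non-wandering set of a family of maps `φ t : X → X`, `t ≥ 0`. -/
def nonWanderingSet {X : Type*} [TopologicalSpace X] (φ : ℝ≥0 → X → X) : Set X :=
  {x | ∀ U ∈ 𝓝 x, ∀ T : ℝ≥0, 0 < T → ∃ t, T ≤ t ∧ (φ t ⁻¹' U ∩ U).Nonempty}

/-- `μ` is a probability measure invariant under `φ`; as usual, this includes (joint)
measurability of `φ`. -/
structure IsInvariantProbability {X : Type*} [MeasurableSpace X] (φ : ℝ≥0 → X → X)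
    (μ : Measure X) : Prop where
  isProbabilityMeasure : IsProbabilityMeasure μ
  measurable : Measurable (fun p : ℝ≥0 × X => φ p.1 p.2)
  measure_preimage : ∀ (t : ℝ≥0) (A : Set X), MeasurableSet A → μ (φ t ⁻¹' A) = μ A

/-- The first positive time at which the trajectory of `x` hits `D`, as an infimum in `[0, ∞]`
(it is `∞` if there is no such time). A continuous semiflow is a `Flow ℝ≥0 X`. -/
def firstHit {X : Type*} [TopologicalSpace X] (ϕ : Flow ℝ≥0 X) (D : Set X) (x : X) : ℝ≥0∞ :=
  ⨅ t ∈ {t : ℝ≥0 | 0 < t ∧ ϕ t x ∈ D}, (t : ℝ≥0∞)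

theorem firstHit_mem {X : Type*} [TopologicalSpace X] (ϕ : Flow ℝ≥0 X) {D : Set X}
    (hD : IsClosed D) (x : X) (hx : firstHit ϕ D x ≠ ⊤) :
    ϕ (firstHit ϕ D x).toNNReal x ∈ D := by
  set S : Set ℝ≥0 := {t : ℝ≥0 | 0 < t ∧ ϕ t x ∈ D} with hS
  have hne : S.Nonempty := by
    by_contra h
    rw [Set.not_nonempty_iff_eq_empty] at h
    apply hx
    simp only [firstHit]
    rw [← hS, h]
    simp
  have h1 : firstHit ϕ D x = ((sInf S : ℝ≥0) : ℝ≥0∞) := (ENNReal.coe_sInf hne).symm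
  rw [h1, ENNReal.toNNReal_coe]
  have hcl : IsClosed {t : ℝ≥0 | ϕ t x ∈ D} :=
    hD.preimage (ϕ.continuous continuous_id continuous_const)
  exact closure_minimal (fun t ht => ht.2) hcl (csInf_mem_closure hne (OrderBot.bddBelow S))

/-- A continuous semiflow `flow` on `X`, a compact set `D ⊆ X` and a continuous map `I : D → X`,
such that all first hitting times of `D` are positive. -/
structure ImpulsiveData (X : Type*) [MetricSpace X] where
  flow : Flow ℝ≥0 X
  D : Set X
  isCompact_D : IsCompact D
  I : D → X
  continuous_I : Continuous I
  firstHit_pos : ∀ x, 0 < firstHit flow D x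

namespace ImpulsiveData

variable {X : Type*} [MetricSpace X] (S : ImpulsiveData X)

/-- The first impulsive time `τ₁`. -/
def tau1 (x : X) : ℝ≥0∞ := firstHit S.flow S.D x

open Classical in
/-- Follow the semiflow until `D` is hit, then apply the impulse: `I (ϕ_{τ₁(y)}(y))`.
If `D` is never hit we return `y` itself (this value is not used: all later impulsive times
are then infinite). -/
def jump (y : X) : X :=
  if h : S.tau1 y = ⊤ then y
  else S.I ⟨S.flow (S.tau1 y).toNNReal y, firstHit_mem S.flow S.isCompact_D.isClosed y h⟩

/-- The position just after the `n`-th impulse; the `0`-th is the initial point. -/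
def pos : ℕ → X → X
  | 0, x => x
  | n + 1, x => S.jump (pos n x)

/-- The `n`-th impulsive time, with the convention that the `0`-th is `0`. -/
def tau : ℕ → X → ℝ≥0∞
  | 0, _ => 0
  | n + 1, x => tau n x + S.tau1 (S.pos n x)

/-- The time length of the impulsive trajectory of `x`. -/
def timeLength (x : X) : ℝ≥0∞ := ⨆ n : ℕ, S.tau (n + 1) x

end ImpulsiveData

/-- An impulsive dynamical system: all impulsive trajectories are defined for all times. -/
structure ImpulsiveSystem (X : Type*) [MetricSpace X] extends ImpulsiveData X where
  timeLength_eq_top : ∀ x, toImpulsiveData.timeLength x = ⊤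

namespace ImpulsiveSystem

variable {X : Type*} [MetricSpace X] (S : ImpulsiveSystem X)

theorem exists_lt_tau (x : X) (t : ℝ≥0) : ∃ n : ℕ, (t : ℝ≥0∞) < S.tau (n + 1) x :=
  lt_iSup_iff.1 (lt_of_lt_of_eq ENNReal.coe_lt_top (S.timeLength_eq_top x).symm)

open Classical in
/-- The number of impulses that act on `x` up to and including time `t`, i.e. the `n` such that
`τ_n(x) ≤ t < τ_{n+1}(x)`. -/
def index (t : ℝ≥0) (x : X) : ℕ := Nat.find (S.exists_lt_tau x t)

/-- The impulsive semiflow: `ϕ_{t - τ_n(x)}` applied to the position after the `n`-th impulse,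
for `τ_n(x) ≤ t < τ_{n+1}(x)`. -/
def semiflow (t : ℝ≥0) (x : X) : X :=
  S.flow (t - (S.tau (S.index t x) x).toNNReal) (S.pos (S.index t x) x)

/-- The non-wandering set of the impulsive semiflow. -/
def Omega : Set X := nonWanderingSet S.semiflow

open Classical in
/-- The function `τ_D` on the non-wandering set: `0` on `D` and `τ₁` off `D`. -/
def tauD (x : S.Omega) : ℝ≥0∞ := if (x : X) ∈ S.D then 0 else S.tau1 x

end ImpulsiveSystem

end Impulsive

end

/-! Existence is a Krylov–Bogolyubov argument that survives the discontinuities. `Ω \ D` is nonempty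
and forward invariant (`semiflow_mem`), so a weak limit μ of time averages along one of its
trajectories lives on the closed set Ω. Impulses on Ω are separated by some δ > 0
(`exists_pos_le_tau1`), so the trajectory spends a fraction O(ε) of its time within ε of the next
impulse; as {τ_D < ε} is relatively open in Ω and contains Ω ∩ D, μ(D) = 0
(`exists_limit_orbitAverage`). Relative to `Ω \ D`, the time-s map is continuous at each point
having no impulse time equal to s (`continuousWithinAt_semiflow`). Level sets of an impulse time are
disjoint, so for all but countably many s the exceptional points are null and μ is invariant under
time s; every s > 0 is a sum of two such times.

For an arbitrary invariant measure, Poincaré recurrence puts the support in Ω, and Fubini gives μ(D)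
= 0, because a trajectory meets D only at the countably many times `tau n`. -/

open Filter

namespace Impulsive

/-! ### First hitting times of a continuous semiflow. -/

section FirstHit

variable {X : Type*} [TopologicalSpace X] (ϕ : Flow ℝ≥0 X) {D : Set X} {x : X}

theorem firstHit_le {t : ℝ≥0} (ht : 0 < t) (h : ϕ t x ∈ D) : firstHit ϕ D x ≤ t :=
  iInf₂_le t ⟨ht, h⟩

theorem notMem_of_lt_firstHit {t : ℝ≥0} (ht : 0 < t) (h : (t : ℝ≥0∞) < firstHit ϕ D x) :
    ϕ t x ∉ D :=
  fun h' => (firstHit_le ϕ ht h').not_gt h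

theorem firstHit_flow_add {r : ℝ≥0} (hr : (r : ℝ≥0∞) < firstHit ϕ D x) :
    firstHit ϕ D (ϕ r x) + r = firstHit ϕ D x := by
  apply le_antisymm
  · refine le_iInf₂ fun t ht => ?_
    have hrt : r < t := by exact_mod_cast hr.trans_le (firstHit_le ϕ ht.1 ht.2)
    have h : firstHit ϕ D (ϕ r x) ≤ (t - r : ℝ≥0) := by
      refine firstHit_le ϕ (tsub_pos_of_lt hrt) ?_
      rw [← ϕ.map_add, tsub_add_cancel_of_le hrt.le]
      exact ht.2
    calc firstHit ϕ D (ϕ r x) + r ≤ ((t - r : ℝ≥0) : ℝ≥0∞) + r := by gcongr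
      _ = t := by rw [← ENNReal.coe_add, tsub_add_cancel_of_le hrt.le]
  · refine (tsub_le_iff_right).1 (le_iInf₂ fun t ht => tsub_le_iff_right.2 ?_)
    have := firstHit_le ϕ (D := D) (x := x) (t := t + r) (add_pos_of_pos_of_nonneg ht.1 zero_le)
      (by rw [ϕ.map_add]; exact ht.2)
    simpa using this

theorem firstHit_lt_iff {a : ℝ≥0∞} :
    firstHit ϕ D x < a ↔ ∃ t : ℝ≥0, 0 < t ∧ (t : ℝ≥0∞) < a ∧ ϕ t x ∈ D := by
  simp only [firstHit, iInf_lt_iff, mem_ofPred_eq]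
  exact ⟨fun ⟨t, ht, h⟩ => ⟨t, ht.1, h, ht.2⟩, fun ⟨t, h1, h2, h3⟩ => ⟨t, ⟨h1, h3⟩, h2⟩⟩

/-- Projection along the compact factor `Icc a b` is a closed map. -/
theorem isClosed_exists_mem_Icc (hD : IsClosed D) (a b : ℝ≥0) :
    IsClosed {x | ∃ t ∈ Icc a b, ϕ t x ∈ D} := by
  have h2 : IsClosed {p : Icc a b × X | ϕ p.1 p.2 ∈ D} :=
    hD.preimage (ϕ.continuous (continuous_subtype_val.comp continuous_fst) continuous_snd)
  have := isClosedMap_snd_of_compactSpace _ h2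
  convert this using 1
  ext x
  simp

theorem measurable_firstHit [MeasurableSpace X] [OpensMeasurableSpace X] (hD : IsClosed D) :
    Measurable (firstHit ϕ D) := by
  refine measurable_of_Iio fun a => ?_
  have : firstHit ϕ D ⁻¹' Iio a = ⋃ (p : ℚ × ℚ) (_ : 0 < (p.1 : ℝ).toNNReal ∧
      ((p.2 : ℝ).toNNReal : ℝ≥0∞) < a),
      {x | ∃ t ∈ Icc (p.1 : ℝ).toNNReal (p.2 : ℝ).toNNReal, ϕ t x ∈ D} := by
    ext x
    simp only [mem_preimage, mem_Iio, firstHit_lt_iff, mem_iUnion, mem_ofPred_eq]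
    constructor
    · rintro ⟨t, h0, ha, ht⟩
      obtain ⟨p, hp0, hpt⟩ := exists_rat_btwn (show (0 : ℝ) < t from h0)
      obtain ⟨c, htc, hca⟩ := ENNReal.lt_iff_exists_nnreal_btwn.1 ha
      obtain ⟨q, hq0, hqt⟩ := exists_rat_btwn (show (t : ℝ) < c by exact_mod_cast htc)
      refine ⟨(p, q), ⟨by simpa using hp0, lt_of_le_of_lt ?_ hca⟩, t, ⟨?_, ?_⟩, ht⟩
      · exact_mod_cast Real.toNNReal_le_iff_le_coe.2 hqt.le
      · exact Real.toNNReal_le_iff_le_coe.2 hpt.le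
      · exact NNReal.le_toNNReal_of_coe_le hq0.le
    · rintro ⟨p, ⟨h0, ha⟩, t, ht, hD⟩
      exact ⟨t, h0.trans_le ht.1, lt_of_le_of_lt (by exact_mod_cast ht.2) ha, hD⟩
  rw [this]
  exact MeasurableSet.iUnion fun p => MeasurableSet.iUnion fun _ =>
    (isClosed_exists_mem_Icc ϕ hD _ _).measurableSet

/-- Including t = 0 makes the time interval compact, hence the assumption `x ∉ D`. -/
theorem eventually_lt_firstHit (hD : IsClosed D) {s : ℝ≥0}
    (hs : (s : ℝ≥0∞) < firstHit ϕ D x) (hx : x ∉ D) :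
    ∀ᶠ z in 𝓝 x, ∀ t ≤ s, ϕ t z ∉ D := by
  have := (isClosed_exists_mem_Icc ϕ hD 0 s).isOpen_compl.mem_nhds (x := x) (by
    rintro ⟨t, ht, h⟩
    rcases eq_or_lt_of_le ht.1 with rfl | h0
    · exact hx (by simpa using h)
    · exact notMem_of_lt_firstHit ϕ h0 (lt_of_le_of_lt (by exact_mod_cast ht.2) hs) h)
  filter_upwards [this] with z hz t ht h
  exact hz ⟨t, ⟨zero_le, ht⟩, h⟩

end FirstHit

/-! ### Arcs of a trajectory and measurability of the impulse data. -/

namespace ImpulsiveData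

variable {X : Type*} [MetricSpace X] (S : ImpulsiveData X)

theorem tau_mono (x : X) : Monotone fun n => S.tau n x :=
  monotone_nat_of_le_succ fun _ => le_self_add

theorem jump_of_ne_top {y : X} (h : S.tau1 y ≠ ⊤) :
    S.jump y = S.I ⟨S.flow (S.tau1 y).toNNReal y,
      firstHit_mem S.flow S.isCompact_D.isClosed y h⟩ := by
  rw [jump, dif_neg h]

theorem jump_of_eq_top {y : X} (h : S.tau1 y = ⊤) : S.jump y = y := by
  rw [jump, dif_pos h]

theorem tau1_flow_add {r : ℝ≥0} {x : X} (hr : (r : ℝ≥0∞) < S.tau1 x) :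
    S.tau1 (S.flow r x) + r = S.tau1 x :=
  firstHit_flow_add S.flow hr

theorem tau1_flow_ne_top {r : ℝ≥0} {x : X} (hr : (r : ℝ≥0∞) < S.tau1 x) (h : S.tau1 x ≠ ⊤) :
    S.tau1 (S.flow r x) ≠ ⊤ := by
  rw [← S.tau1_flow_add hr] at h
  exact (ENNReal.add_ne_top.1 h).1

theorem jump_flow {r : ℝ≥0} {x : X} (hr : (r : ℝ≥0∞) < S.tau1 x) (h : S.tau1 x ≠ ⊤) :
    S.jump (S.flow r x) = S.jump x := by
  rw [S.jump_of_ne_top h, S.jump_of_ne_top (S.tau1_flow_ne_top hr h)]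
  congr 2
  rw [← S.flow.map_add]
  congr 1
  rw [← S.tau1_flow_add hr, ENNReal.toNNReal_add (S.tau1_flow_ne_top hr h) ENNReal.coe_ne_top,
    ENNReal.toNNReal_coe]

/-- If `y` lies on the `n`-th arc of the trajectory of `x`, its later positions are those
of `x`. -/
theorem pos_succ_arc {n : ℕ} {x : X} {r : ℝ≥0} (hr : (r : ℝ≥0∞) < S.tau1 (S.pos n x))
    (h : S.tau1 (S.pos n x) ≠ ⊤) (m : ℕ) :
    S.pos (m + 1) (S.flow r (S.pos n x)) = S.pos (n + m + 1) x := by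
  induction m with
  | zero => exact S.jump_flow hr h
  | succ m ih =>
    change S.jump (S.pos (m + 1) _) = S.jump (S.pos (n + m + 1) x)
    rw [ih]

theorem tau_succ_arc {n : ℕ} {x : X} {r : ℝ≥0} (hr : (r : ℝ≥0∞) < S.tau1 (S.pos n x)) (m : ℕ) :
    S.tau (m + 1) (S.flow r (S.pos n x)) + (S.tau n x + r) = S.tau (n + m + 1) x := by
  -- Without a next impulse `jump` is a default value and `pos_succ_arc` fails; both sides are then
  -- infinite.
  by_cases h : S.tau1 (S.pos n x) = ⊤
  · have h1 : S.tau (n + m + 1) x = ⊤ := by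
      refine top_le_iff.1 (le_trans ?_ (S.tau_mono x (show n + 1 ≤ n + m + 1 by omega)))
      simp [tau, h]
    have h2 : S.tau (m + 1) (S.flow r (S.pos n x)) = ⊤ := by
      refine top_le_iff.1 (le_trans ?_ (S.tau_mono _ (show 1 ≤ m + 1 by omega)))
      have := S.tau1_flow_add hr
      rw [h] at this
      have h3 : S.tau1 (S.flow r (S.pos n x)) = ⊤ := by simpa using this
      simp [tau, pos, h3]
    rw [h1, h2, top_add]
  · induction m with
    | zero =>
      have := S.tau1_flow_add hr
      simp only [tau, pos, zero_add]
      rw [← this]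
      ring
    | succ m ih =>
      change S.tau (m + 1) _ + S.tau1 (S.pos (m + 1) _) + _ =
        S.tau (n + m + 1) x + S.tau1 (S.pos (n + m + 1) x)
      rw [← ih, S.pos_succ_arc hr h]
      ring

theorem measurable_tau1 [MeasurableSpace X] [BorelSpace X] : Measurable S.tau1 :=
  measurable_firstHit S.flow S.isCompact_D.isClosed

theorem measurable_jump [MeasurableSpace X] [BorelSpace X] [SecondCountableTopology X] :
    Measurable S.jump := by
  classical
  have hs : MeasurableSet {y | S.tau1 y = ⊤} := S.measurable_tau1 (measurableSet_singleton ⊤)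
  have hg : Measurable fun y : X => S.flow (S.tau1 y).toNNReal y := by
    have : Measurable (fun p : ℝ≥0 × X => S.flow p.1 p.2) := S.flow.cont'.measurable
    exact this.comp (S.measurable_tau1.ennreal_toNNReal.prodMk measurable_id)
  have h2 : Measurable fun y : ({y | S.tau1 y = ⊤}ᶜ : Set X) =>
      S.I ⟨S.flow (S.tau1 y).toNNReal y, firstHit_mem S.flow S.isCompact_D.isClosed y y.2⟩ :=
    S.continuous_I.measurable.comp (Measurable.subtype_mk (hg.comp measurable_subtype_coe))
  convert Measurable.dite (s := {y | S.tau1 y = ⊤}) (f := fun y => (y : X))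
    measurable_subtype_coe h2 hs using 1
  ext y
  by_cases h : S.tau1 y = ⊤
  · simp [jump, h]
  · simp [jump, h]

theorem measurable_pos [MeasurableSpace X] [BorelSpace X] [SecondCountableTopology X] (n : ℕ) :
    Measurable (S.pos n) := by
  induction n with
  | zero => exact measurable_id
  | succ n ih => exact S.measurable_jump.comp ih

theorem measurable_tau [MeasurableSpace X] [BorelSpace X] [SecondCountableTopology X] (n : ℕ) :
    Measurable (S.tau n) := by
  induction n with
  | zero => exact measurable_const
  | succ n ih => exact ih.add (S.measurable_tau1.comp (S.measurable_pos n))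

end ImpulsiveData

/-! ### Semigroup law and measurability of the impulsive semiflow. -/

namespace ImpulsiveSystem

variable {X : Type*} [MetricSpace X] (S : ImpulsiveSystem X)

theorem lt_tau_index_succ (t : ℝ≥0) (x : X) : (t : ℝ≥0∞) < S.tau (S.index t x + 1) x := by
  classical
  exact Nat.find_spec (S.exists_lt_tau x t)

theorem tau_index_le (t : ℝ≥0) (x : X) : S.tau (S.index t x) x ≤ t := by
  classical
  rcases h : S.index t x with _ | m
  · exact zero_le
  · have : m < S.index t x := by omega
    exact not_lt.1 (Nat.find_min (S.exists_lt_tau x t) this)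

theorem index_eq {t : ℝ≥0} {x : X} {n : ℕ} (h1 : S.tau n x ≤ t)
    (h2 : (t : ℝ≥0∞) < S.tau (n + 1) x) : S.index t x = n := by
  apply le_antisymm
  · by_contra h
    exact absurd h2 (not_lt.2 ((S.tau_mono x (show n + 1 ≤ S.index t x by omega)).trans
      (S.tau_index_le t x)))
  · by_contra h
    exact absurd (S.lt_tau_index_succ t x) (not_lt.2 ((S.tau_mono x
      (show S.index t x + 1 ≤ n by omega)).trans h1))

theorem semiflow_eq {t : ℝ≥0} {x : X} {n : ℕ} (h1 : S.tau n x ≤ t)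
    (h2 : (t : ℝ≥0∞) < S.tau (n + 1) x) :
    S.semiflow t x = S.flow (t - (S.tau n x).toNNReal) (S.pos n x) := by
  rw [semiflow, S.index_eq h1 h2]

theorem semiflow_of_lt_tau1 {t : ℝ≥0} {x : X} (h : (t : ℝ≥0∞) < S.tau1 x) :
    S.semiflow t x = S.flow t x := by
  rw [S.semiflow_eq (n := 0) zero_le (by simpa [ImpulsiveData.tau, ImpulsiveData.pos] using h)]
  simp [ImpulsiveData.tau, ImpulsiveData.pos]

theorem semiflow_zero (x : X) : S.semiflow 0 x = x := by
  rw [S.semiflow_of_lt_tau1 (by simpa [ImpulsiveData.tau1] using S.firstHit_pos x)]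
  simp

/-- Every point of the trajectory of `x` lies on an arc of it. -/
theorem exists_arc (t : ℝ≥0) (x : X) : ∃ (n : ℕ) (r : ℝ≥0), S.tau n x + r = t ∧
    (r : ℝ≥0∞) < S.tau1 (S.pos n x) ∧ S.semiflow t x = S.flow r (S.pos n x) := by
  have h1 := S.tau_index_le t x
  have h2 := S.lt_tau_index_succ t x
  have hT : S.tau (S.index t x) x ≠ ⊤ := ne_top_of_le_ne_top ENNReal.coe_ne_top h1
  have h3 : S.tau (S.index t x) x + (t - (S.tau (S.index t x) x).toNNReal : ℝ≥0) = t := by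
    rw [ENNReal.coe_sub, ENNReal.coe_toNNReal hT, add_tsub_cancel_of_le h1]
  refine ⟨S.index t x, t - (S.tau (S.index t x) x).toNNReal, h3, ?_, rfl⟩
  rw [ImpulsiveData.tau] at h2
  rw [← h3] at h2
  exact lt_of_add_lt_add_left h2

theorem semiflow_eq_flow {t r : ℝ≥0} {x : X} {n : ℕ} (h1 : S.tau n x + r = t)
    (h2 : (r : ℝ≥0∞) < S.tau1 (S.pos n x)) : S.semiflow t x = S.flow r (S.pos n x) := by
  have hT : S.tau n x ≠ ⊤ := ne_top_of_le_ne_top ENNReal.coe_ne_top (h1 ▸ le_self_add)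
  rw [S.semiflow_eq (n := n) (h1 ▸ le_self_add)
    (h1 ▸ (ENNReal.add_lt_add_iff_left hT).2 h2)]
  congr 1
  lift S.tau n x to ℝ≥0 using hT with a
  have : a + r = t := by exact_mod_cast h1
  simp [← this]

theorem semiflow_add (s t : ℝ≥0) (x : X) :
    S.semiflow (s + t) x = S.semiflow s (S.semiflow t x) := by
  obtain ⟨n, r, hn, hr, hy⟩ := S.exists_arc t x
  obtain ⟨m, q, hm, hq, hz⟩ := S.exists_arc s (S.semiflow t x)
  rw [hz]
  -- Either no impulse occurs during the additional time s, or the end point lies on a later arc of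
  -- `x`.
  rcases m with _ | m
  · have hqs : q = s := by
      simpa [ImpulsiveData.tau] using hm
    subst hqs
    rw [hy] at hq ⊢
    simp only [ImpulsiveData.pos] at hq ⊢
    rw [← S.flow.map_add]
    refine S.semiflow_eq_flow (n := n) ?_ ?_
    · push_cast
      rw [← hn]
      ring
    · rw [← S.tau1_flow_add hr]
      push_cast
      exact (ENNReal.add_lt_add_iff_right ENNReal.coe_ne_top).2 hq
  · rw [hy] at hm hq ⊢
    have htop : S.tau1 (S.pos n x) ≠ ⊤ := by
      have h1 : S.tau (m + 1) (S.flow r (S.pos n x)) ≠ ⊤ :=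
        ne_top_of_le_ne_top ENNReal.coe_ne_top (hm ▸ le_self_add)
      have h2 : S.tau 1 (S.flow r (S.pos n x)) ≠ ⊤ :=
        ne_top_of_le_ne_top h1 (S.tau_mono _ (by omega))
      have h3 : S.tau1 (S.flow r (S.pos n x)) ≠ ⊤ := by
        simpa [ImpulsiveData.tau, ImpulsiveData.pos] using h2
      rw [← S.tau1_flow_add hr]
      exact ENNReal.add_ne_top.2 ⟨h3, ENNReal.coe_ne_top⟩
    rw [S.pos_succ_arc hr htop] at hq ⊢
    refine S.semiflow_eq_flow (n := n + m + 1) ?_ hq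
    rw [← S.tau_succ_arc hr m]
    push_cast
    rw [← hm, ← hn]
    ring

theorem iterate_semiflow (t : ℝ≥0) (n : ℕ) (x : X) :
    (S.semiflow t)^[n] x = S.semiflow (n * t) x := by
  induction n with
  | zero => simp [S.semiflow_zero]
  | succ n ih =>
    rw [Function.iterate_succ_apply', ih, ← S.semiflow_add]
    congr 1
    push_cast
    ring

theorem measurable_semiflow [MeasurableSpace X] [BorelSpace X] [SecondCountableTopology X] :
    Measurable fun p : ℝ≥0 × X => S.semiflow p.1 p.2 := by
  classical
  have hflow : Measurable (fun p : ℝ≥0 × X => S.flow p.1 p.2) := S.flow.cont'.measurable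
  refine Measurable.find (f := fun n (p : ℝ≥0 × X) =>
    S.flow (p.1 - (S.tau n p.2).toNNReal) (S.pos n p.2))
    (p := fun n p => (p.1 : ℝ≥0∞) < S.tau (n + 1) p.2) (fun n => ?_) (fun n => ?_)
    (fun p => S.exists_lt_tau p.2 p.1)
  · exact hflow.comp ((measurable_fst.sub
      ((S.measurable_tau n).comp measurable_snd).ennreal_toNNReal).prodMk
      ((S.measurable_pos n).comp measurable_snd))
  · exact measurableSet_lt measurable_fst.coe_nnreal_ennreal
      ((S.measurable_tau (n + 1)).comp measurable_snd)

theorem measurable_semiflow_apply [MeasurableSpace X] [BorelSpace X] [SecondCountableTopology X]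
    (t : ℝ≥0) : Measurable (S.semiflow t) :=
  S.measurable_semiflow.comp measurable_prodMk_left

theorem measurable_orbit [MeasurableSpace X] [BorelSpace X] [SecondCountableTopology X]
    (x : X) : Measurable fun t => S.semiflow t x :=
  S.measurable_semiflow.comp measurable_prodMk_right

/-- The first hitting time decreases with unit speed along each arc of a trajectory. -/
theorem exists_tau1_semiflow_add (t : ℝ≥0) (x : X) : ∃ n : ℕ, S.tau n x ≤ t ∧
    S.tau1 (S.semiflow t x) + t = S.tau (n + 1) x := by
  obtain ⟨n, r, hn, hr, hy⟩ := S.exists_arc t x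
  refine ⟨n, hn ▸ le_self_add, ?_⟩
  rw [hy, ← hn, ImpulsiveData.tau, ← S.tau1_flow_add hr]
  ring

/-- The interior of an arc avoids D; only its initial point can lie in D. -/
theorem exists_tau_eq_of_semiflow_mem {t : ℝ≥0} {x : X} (h : S.semiflow t x ∈ S.D) :
    ∃ n : ℕ, S.tau n x = t := by
  obtain ⟨n, r, hn, hr, hy⟩ := S.exists_arc t x
  rcases eq_or_lt_of_le (zero_le : 0 ≤ r) with rfl | h0
  · exact ⟨n, by simpa using hn⟩
  · exact absurd (hy ▸ h) (notMem_of_lt_firstHit S.flow h0 hr)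

end ImpulsiveSystem

end Impulsive

/-! ### The non-wandering set and its forward invariance off D. -/

namespace Impulsive

theorem isClosed_nonWanderingSet {X : Type*} [TopologicalSpace X] (φ : ℝ≥0 → X → X) :
    IsClosed (nonWanderingSet φ) := by
  refine isClosed_of_closure_subset fun x hx U hU T hT => ?_
  obtain ⟨y, hyU, hy⟩ := mem_closure_iff_nhds.1 hx _ (interior_mem_nhds.2 hU)
  obtain ⟨t, ht, z, hz⟩ := hy _ (isOpen_interior.mem_nhds hyU) T hT
  exact ⟨t, ht, z, preimage_mono interior_subset hz.1, interior_subset hz.2⟩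

namespace ImpulsiveSystem

variable {X : Type*} [MetricSpace X] (S : ImpulsiveSystem X)

theorem isClosed_Omega : IsClosed S.Omega :=
  isClosed_nonWanderingSet _

/-- A cluster point of an integer-time orbit is non-wandering: two visits to U at distance at least
T give the return. -/
theorem nonempty_Omega [CompactSpace X] [Nonempty X] : S.Omega.Nonempty := by
  obtain ⟨x⟩ := ‹Nonempty X›
  obtain ⟨y, hy⟩ := exists_clusterPt_of_compactSpace
    (map (fun n : ℕ => S.semiflow n x) atTop)
  refine ⟨y, fun U hU T _ => ?_⟩
  have hf : ∃ᶠ n : ℕ in atTop, S.semiflow n x ∈ U :=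
    mapClusterPt_iff_frequently.1 hy U hU
  obtain ⟨m, -, hm⟩ := frequently_atTop.1 hf 0
  obtain ⟨k, hk⟩ := exists_nat_ge T
  obtain ⟨n, hn, hn'⟩ := frequently_atTop.1 hf (m + k)
  have hmn : (m : ℝ≥0) + k ≤ n := by exact_mod_cast hn
  refine ⟨n - m, le_tsub_of_add_le_left ((add_le_add_right hk _).trans hmn), S.semiflow m x, ?_, hm⟩
  rw [mem_preimage, ← S.semiflow_add, tsub_add_cancel_of_le (le_self_add.trans hmn)]
  exact hn'

/-- Near x no impulse occurs up to time s, so the semiflow at time s is continuous there; it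
commutes with the semiflow at time t and carries returns near x to returns near the image. -/
theorem flow_mem_Omega {x : X} (hx : x ∈ S.Omega \ S.D) {s : ℝ≥0}
    (hs : (s : ℝ≥0∞) < S.tau1 x) : S.flow s x ∈ S.Omega := by
  intro V hV T hT
  have h1 := eventually_lt_firstHit S.flow S.isCompact_D.isClosed hs hx.2
  have hc : Continuous (S.flow s) := S.flow.continuous continuous_const continuous_id
  have h2 := hc.continuousAt.preimage_mem_nhds hV
  have key : ∀ᶠ z in 𝓝 x, S.semiflow s z = S.flow s z := by
    filter_upwards [h1] with z hz
    refine S.semiflow_of_lt_tau1 ?_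
    by_contra h
    have htop : S.tau1 z ≠ ⊤ := ne_top_of_le_ne_top ENNReal.coe_ne_top (not_lt.1 h)
    refine hz (S.tau1 z).toNNReal ?_ (firstHit_mem S.flow S.isCompact_D.isClosed z htop)
    exact ENNReal.toNNReal_mono ENNReal.coe_ne_top (not_lt.1 h)
  obtain ⟨t, ht, z, hz1, hz2⟩ := hx.1 _ (inter_mem key h2) T hT
  refine ⟨t, ht, S.semiflow s z, ?_, ?_⟩
  · rw [mem_preimage, ← S.semiflow_add, add_comm, S.semiflow_add, hz1.1]
    exact hz1.2
  · rw [hz2.1]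
    exact hz2.2

theorem flow_notMem_D {x : X} (hx : x ∈ S.Omega \ S.D) {s : ℝ≥0}
    (hs : (s : ℝ≥0∞) < S.tau1 x) : S.flow s x ∉ S.D := by
  rcases eq_or_lt_of_le (zero_le : 0 ≤ s) with rfl | h0
  · simpa using hx.2
  · exact notMem_of_lt_firstHit S.flow h0 hs

/-- Let s increase to τ₁(x) in `flow_mem_Omega`, using that Ω is closed. -/
theorem flow_tau1_mem_Omega {x : X} (hx : x ∈ S.Omega \ S.D) (h : S.tau1 x ≠ ⊤) :
    S.flow (S.tau1 x).toNNReal x ∈ S.Omega := by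
  set a := (S.tau1 x).toNNReal with ha
  have ha' : (a : ℝ≥0∞) = S.tau1 x := ENNReal.coe_toNNReal h
  have h0 : 0 < a := by
    have := S.firstHit_pos x
    change 0 < S.tau1 x at this
    rw [← ha'] at this
    exact_mod_cast this
  have hc : Continuous fun s => S.flow s x := S.flow.continuous continuous_id continuous_const
  have hmem : a ∈ closure (Iio a) := by
    rw [closure_Iio' (a := a) ⟨0, h0⟩]
    exact self_mem_Iic
  have := hc.continuousAt.continuousWithinAt.mem_closure hmem (t := S.Omega) fun s hs =>
    S.flow_mem_Omega hx (by rw [← ha']; exact_mod_cast hs)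
  rwa [S.isClosed_Omega.closure_eq] at this

section Invariance

variable (hI : S.I '' {d | (d : X) ∈ S.Omega} ⊆ S.Omega \ S.D)

theorem jump_mem_image {x : X} (hx : x ∈ S.Omega \ S.D) (h : S.tau1 x ≠ ⊤) :
    S.jump x ∈ S.I '' {d | (d : X) ∈ S.Omega} := by
  rw [S.jump_of_ne_top h]
  exact mem_image_of_mem _ (S.flow_tau1_mem_Omega hx h)

include hI

theorem jump_mem {x : X} (hx : x ∈ S.Omega \ S.D) : S.jump x ∈ S.Omega \ S.D := by
  by_cases h : S.tau1 x = ⊤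
  · rwa [S.jump_of_eq_top h]
  · exact hI (S.jump_mem_image hx h)

theorem pos_mem {x : X} (hx : x ∈ S.Omega \ S.D) (n : ℕ) : S.pos n x ∈ S.Omega \ S.D := by
  induction n with
  | zero => exact hx
  | succ n ih => exact S.jump_mem hI ih

theorem semiflow_mem {x : X} (hx : x ∈ S.Omega \ S.D) (t : ℝ≥0) :
    S.semiflow t x ∈ S.Omega \ S.D := by
  obtain ⟨n, r, -, hr, hy⟩ := S.exists_arc t x
  rw [hy]
  exact ⟨S.flow_mem_Omega (S.pos_mem hI hx n) hr, S.flow_notMem_D (S.pos_mem hI hx n) hr⟩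

theorem nonempty_Omega_diff_D [CompactSpace X] [Nonempty X] : (S.Omega \ S.D).Nonempty := by
  obtain ⟨x, hx⟩ := S.nonempty_Omega
  by_cases h : x ∈ S.D
  · exact ⟨S.I ⟨x, h⟩, hI (mem_image_of_mem _ hx)⟩
  · exact ⟨x, hx, h⟩

end Invariance

/-! ### Continuity relative to `Ω \ D` and separation of impulses. -/

section Continuity

variable (hτ : Continuous S.tauD)

include hτ

theorem continuousOn_tau1 : ContinuousOn S.tau1 (S.Omega \ S.D) := by
  classical
  have h1 : ContinuousOn (fun x => if x ∈ S.D then 0 else S.tau1 x) S.Omega :=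
    continuousOn_iff_continuous_domRestrict.2 (hτ.congr fun x => by simp [tauD])
  exact (h1.mono sdiff_subset).congr fun x hx => by simp [hx.2]

theorem continuousWithinAt_jump {x : X} (hx : x ∈ S.Omega \ S.D) (h : S.tau1 x ≠ ⊤) :
    ContinuousWithinAt S.jump (S.Omega \ S.D) x := by
  have ht := S.continuousOn_tau1 hτ x hx
  have hfin : ∀ᶠ z in 𝓝[S.Omega \ S.D] x, S.tau1 z ≠ ⊤ :=
    ht.eventually (isOpen_ne.mem_nhds h)
  have hg : ContinuousWithinAt (fun y => S.flow (S.tau1 y).toNNReal y) (S.Omega \ S.D) x :=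
    S.flow.cont'.continuousAt.tendsto.comp
      (((ENNReal.tendsto_toNNReal h).comp ht).prodMk_nhds continuousWithinAt_id)
  have hg' : Tendsto (fun y => S.flow (S.tau1 y).toNNReal y) (𝓝[S.Omega \ S.D] x)
    (𝓝[S.D] (S.flow (S.tau1 x).toNNReal x)) :=
    tendsto_nhdsWithin_iff.2 ⟨hg, hfin.mono fun z hz =>
      firstHit_mem S.flow S.isCompact_D.isClosed z hz⟩
  classical
  -- Extending I to all of X avoids composing with a point of the subtype that exists only where τ₁
  -- is finite.
  let J : X → X := fun y => if hy : y ∈ S.D then S.I ⟨y, hy⟩ else y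
  have hJ : ContinuousOn J S.D := by
    rw [continuousOn_iff_continuous_domRestrict]
    refine S.continuous_I.congr fun y => ?_
    simp [J]
  have hmem := firstHit_mem S.flow S.isCompact_D.isClosed x h
  have hcomp := (hJ _ hmem).tendsto.comp hg'
  have heq : ∀ z, S.tau1 z ≠ ⊤ → J (S.flow (S.tau1 z).toNNReal z) = S.jump z := by
    intro z hz
    have := firstHit_mem S.flow S.isCompact_D.isClosed z hz
    rw [S.jump_of_ne_top hz]
    exact dif_pos this
  rw [ContinuousWithinAt, ← heq x h]
  exact hcomp.congr' (hfin.mono heq)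

variable (hI : S.I '' {d | (d : X) ∈ S.Omega} ⊆ S.Omega \ S.D)

include hI

theorem continuousWithinAt_pos {x : X} (hx : x ∈ S.Omega \ S.D) {n : ℕ} (h : S.tau n x ≠ ⊤) :
    ContinuousWithinAt (S.pos n) (S.Omega \ S.D) x := by
  induction n with
  | zero => exact continuousWithinAt_id
  | succ n ih =>
    rw [ImpulsiveData.tau, ENNReal.add_ne_top] at h
    exact (S.continuousWithinAt_jump hτ (S.pos_mem hI hx n) h.2).comp (ih h.1)
      fun z hz => S.pos_mem hI hz n

/-- Continuity reaches one index beyond finiteness: τ₁ is continuous even where infinite, and only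
the jump needs a finite hitting time. -/
theorem continuousWithinAt_tau {x : X} (hx : x ∈ S.Omega \ S.D) {n : ℕ} (h : S.tau n x ≠ ⊤) :
    ContinuousWithinAt (S.tau (n + 1)) (S.Omega \ S.D) x := by
  induction n with
  | zero => simpa [ImpulsiveData.tau, ImpulsiveData.pos] using! S.continuousOn_tau1 hτ x hx
  | succ n ih =>
    have h' := h
    rw [ImpulsiveData.tau, ENNReal.add_ne_top] at h'
    exact (ih h'.1).add ((S.continuousOn_tau1 hτ _ (S.pos_mem hI hx (n + 1))).comp
      (S.continuousWithinAt_pos hτ hI hx h) fun z hz => S.pos_mem hI hz (n + 1))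

/-- The strict inequalities `tau n x < s < tau (n + 1) x` persist nearby, so the number of impulses
is locally constant. -/
theorem continuousWithinAt_semiflow {x : X} (hx : x ∈ S.Omega \ S.D) {s : ℝ≥0}
    (hs : ∀ n, S.tau n x ≠ s) : ContinuousWithinAt (S.semiflow s) (S.Omega \ S.D) x := by
  set n := S.index s x with hn
  have h1 : S.tau n x < s := lt_of_le_of_ne (S.tau_index_le s x) (hs n)
  have h2 := S.lt_tau_index_succ s x
  rw [← hn] at h2
  have htop : S.tau n x ≠ ⊤ := ne_top_of_lt h1
  have hc : ContinuousWithinAt (S.tau n) (S.Omega \ S.D) x := by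
    rcases h : n with _ | m
    · exact continuousWithinAt_const
    · rw [h, ImpulsiveData.tau] at htop
      exact S.continuousWithinAt_tau hτ hI hx (ENNReal.add_ne_top.1 htop).1
  have hc' := S.continuousWithinAt_tau hτ hI hx htop
  have heq : ∀ᶠ z in 𝓝[S.Omega \ S.D] x,
      S.semiflow s z = S.flow (s - (S.tau n z).toNNReal) (S.pos n z) := by
    filter_upwards [hc.eventually (gt_mem_nhds h1), hc'.eventually (lt_mem_nhds h2)]
      with z hz1 hz2 using S.semiflow_eq hz1.le hz2
  have hlim : ContinuousWithinAt (fun z => S.flow (s - (S.tau n z).toNNReal) (S.pos n z))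
      (S.Omega \ S.D) x :=
    S.flow.cont'.continuousAt.tendsto.comp
      ((tendsto_const_nhds.sub ((ENNReal.tendsto_toNNReal htop).comp hc)).prodMk_nhds
        (S.continuousWithinAt_pos hτ hI hx htop))
  exact hlim.congr_of_eventuallyEq heq (S.semiflow_eq h1.le h2)

/-- The impulses on the non-wandering set are separated by a positive time. -/
theorem exists_pos_le_tau1 : ∃ δ : ℝ≥0, 0 < δ ∧
    ∀ x ∈ S.I '' {d | (d : X) ∈ S.Omega}, (δ : ℝ≥0∞) ≤ S.tau1 x := by
  have : CompactSpace S.D := isCompact_iff_compactSpace.1 S.isCompact_D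
  have hK : IsCompact (S.I '' {d | (d : X) ∈ S.Omega}) :=
    (S.isClosed_Omega.preimage continuous_subtype_val).isCompact.image S.continuous_I
  rcases (S.I '' {d | (d : X) ∈ S.Omega}).eq_empty_or_nonempty with h | h
  · exact ⟨1, one_pos, by simp [h]⟩
  -- The compact image lies off D, where τ₁ is continuous, so its minimum is attained and positive;
  -- it may be ∞, so δ is taken below it.
  · obtain ⟨x, -, hmin⟩ := hK.exists_isMinOn h ((S.continuousOn_tau1 hτ).mono hI)
    obtain ⟨δ, hδ0, hδ⟩ := ENNReal.lt_iff_exists_nnreal_btwn.1 (S.firstHit_pos x)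
    exact ⟨δ, by exact_mod_cast hδ0, fun y hy => hδ.le.trans (hmin hy)⟩

/-- The factor is n and not n + 1 because the first waiting time can be arbitrarily short. -/
theorem exists_pos_mul_le_tau : ∃ δ : ℝ≥0, 0 < δ ∧
    ∀ x ∈ S.Omega \ S.D, ∀ n : ℕ, ((n * δ : ℝ≥0) : ℝ≥0∞) ≤ S.tau (n + 1) x := by
  obtain ⟨δ, hδ0, hδ⟩ := S.exists_pos_le_tau1 hτ hI
  refine ⟨δ, hδ0, fun x hx n => ?_⟩
  induction n with
  | zero => simp
  | succ n ih =>
    by_cases h : S.tau (n + 1) x = ⊤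
    · rw [ImpulsiveData.tau, h, top_add]
      exact le_top
    · rw [ImpulsiveData.tau]
      have h1 : S.tau1 (S.pos n x) ≠ ⊤ := by
        rw [ImpulsiveData.tau, ← ne_eq, ENNReal.add_ne_top] at h
        exact h.2
      have h2 := hδ _ (S.jump_mem_image (S.pos_mem hI hx n) h1)
      calc (((n + 1 : ℕ) * δ : ℝ≥0) : ℝ≥0∞) = (n * δ : ℝ≥0) + δ := by
            push_cast
            ring
        _ ≤ _ := add_le_add ih h2

end Continuity

end ImpulsiveSystem

end Impulsive

/-! ### A criterion for equality of measures; properties of all invariant measures. -/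

namespace Impulsive

/-- Two Borel probability measures agree as soon as `μ G ≤ ν (closure G)` for open `G`. -/
theorem eq_of_forall_isOpen_le_closure {X : Type*} [MetricSpace X] [MeasurableSpace X]
    [BorelSpace X] {μ ν : Measure X} [IsProbabilityMeasure μ] [IsProbabilityMeasure ν]
    (h : ∀ G, IsOpen G → μ G ≤ ν (closure G)) : μ = ν := by
  have hcl : ∀ F, IsClosed F → μ F ≤ ν F := by
    intro F hF
    have hlim := tendsto_measure_cthickening_of_isClosed (μ := ν)
      ⟨1, one_pos, measure_ne_top _ _⟩ hF
    refine ge_of_tendsto (hlim.mono_left (nhdsWithin_le_nhds (s := Ioi 0))) ?_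
    filter_upwards [self_mem_nhdsWithin] with r hr
    calc μ F ≤ μ (Metric.thickening r F) := measure_mono (Metric.self_subset_thickening hr F)
      _ ≤ ν (closure (Metric.thickening r F)) := h _ Metric.isOpen_thickening
      _ ≤ _ := measure_mono (Metric.closure_thickening_subset_cthickening r F)
  have hop : ∀ U, IsOpen U → μ U ≤ ν U := by
    intro U hU
    rw [hU.measure_eq_iSup_isClosed μ]
    exact iSup₂_le fun K hKU => iSup_le fun hK => (hcl K hK).trans (measure_mono hKU)
  refine ext_of_generate_finite _ (by rw [BorelSpace.measurable_eq (α := X),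
    borel_eq_generateFrom_isClosed]) isPiSystem_isClosed (fun F hF => ?_) (by simp)
  refine le_antisymm (hcl F hF) ?_
  have hF' : IsClosed F := hF
  rw [← compl_compl F, prob_compl_eq_one_sub hF'.isOpen_compl.measurableSet,
    prob_compl_eq_one_sub hF'.isOpen_compl.measurableSet]
  exact tsub_le_tsub_left (hop _ hF'.isOpen_compl) 1

namespace ImpulsiveSystem

variable {X : Type*} [MetricSpace X] (S : ImpulsiveSystem X)

/-- Poincaré recurrence for the time-T map: a return after m ≥ 1 iterates happens at time mT ≥ T. -/
theorem support_subset_Omega [MeasurableSpace X] [OpensMeasurableSpace X] {μ : Measure X}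
    (hμ : IsInvariantProbability S.semiflow μ) :
    μ.support ⊆ S.Omega := by
  intro x hx U hU T _
  have := hμ.isProbabilityMeasure
  have hm : Measurable (S.semiflow T) := hμ.measurable.comp measurable_prodMk_left
  have hp : MeasurePreserving (S.semiflow T) μ μ :=
    ⟨hm, Measure.ext fun A hA => by rw [Measure.map_apply hm hA, hμ.measure_preimage T A hA]⟩
  have hpos : 0 < μ (interior U) :=
    Measure.mem_support_iff_forall x |>.1 hx _ (interior_mem_nhds.2 hU)
  obtain ⟨y, hy, m, hm0, hym⟩ := hp.exists_mem_iterate_mem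
    isOpen_interior.measurableSet.nullMeasurableSet hpos.ne'
  rw [S.iterate_semiflow] at hym
  refine ⟨m * T, ?_, y, preimage_mono interior_subset hym, interior_subset hy⟩
  exact le_mul_of_one_le_left zero_le (by exact_mod_cast Nat.one_le_iff_ne_zero.2 hm0)

theorem countable_hitting_times (x : X) :
    {t : ℝ | 0 ≤ t ∧ S.semiflow t.toNNReal x ∈ S.D}.Countable := by
  refine (countable_range fun n => (S.tau n x).toReal).mono ?_
  rintro t ⟨ht0, ht⟩
  obtain ⟨n, hn⟩ := S.exists_tau_eq_of_semiflow_mem ht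
  exact ⟨n, by simp [hn, ht0]⟩

/-- Fubini on X × [0, 1]: fibres over points are countable, while fibres over times all have measure
μ(D). -/
theorem measure_D_eq_zero [MeasurableSpace X] [OpensMeasurableSpace X] {μ : Measure X}
    (hμ : IsInvariantProbability S.semiflow μ) : μ S.D = 0 := by
  have := hμ.isProbabilityMeasure
  have hD : MeasurableSet S.D := S.isCompact_D.isClosed.measurableSet
  set ν : Measure ℝ := volume.restrict (Icc 0 1) with hν
  have hE : MeasurableSet {p : X × ℝ | S.semiflow p.2.toNNReal p.1 ∈ S.D} :=
    (hμ.measurable.comp (measurable_snd.real_toNNReal.prodMk measurable_fst)) hD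
  have h0 : μ.prod ν {p : X × ℝ | S.semiflow p.2.toNNReal p.1 ∈ S.D} = 0 := by
    refine (Measure.measure_prod_null hE).2 (Eventually.of_forall fun x => ?_)
    change ν {t : ℝ | S.semiflow t.toNNReal x ∈ S.D} = 0
    rw [hν, Measure.restrict_apply' measurableSet_Icc]
    exact measure_mono_null
      (t := {t : ℝ | 0 ≤ t ∧ S.semiflow t.toNNReal x ∈ S.D}) (fun t ht => ⟨ht.2.1, ht.1⟩)
      ((S.countable_hitting_times x).measure_zero volume)
  rw [Measure.prod_apply_symm hE] at h0
  have h1 : ∀ t : ℝ, μ ((fun x => (x, t)) ⁻¹' {p : X × ℝ | S.semiflow p.2.toNNReal p.1 ∈ S.D})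
      = μ S.D := fun t => hμ.measure_preimage t.toNNReal S.D hD
  simp_rw [h1] at h0
  simpa [hν] using h0

/-- The distribution of the trajectory of `x` over the time interval `[0, n + 1]`. -/
noncomputable def orbitAverage [MeasurableSpace X] (x : X) (n : ℕ) : Measure X :=
  ((n + 1 : ℝ≥0∞)⁻¹ • volume.restrict (Icc (0 : ℝ) (n + 1))).map
    fun t => S.semiflow t.toNNReal x

/-! ### Occupation times of a single trajectory. -/

section OrbitAverage

variable [MeasurableSpace X] [BorelSpace X] [SecondCountableTopology X]

theorem orbitAverage_apply (x : X) (n : ℕ) {A : Set X} (hA : MeasurableSet A) :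
    S.orbitAverage x n A = (n + 1 : ℝ≥0∞)⁻¹ *
      volume {t ∈ Icc (0 : ℝ) (n + 1) | S.semiflow t.toNNReal x ∈ A} := by
  have hm : Measurable fun t : ℝ => S.semiflow t.toNNReal x :=
    (S.measurable_orbit x).comp measurable_real_toNNReal
  rw [orbitAverage, Measure.map_apply hm hA,
    Measure.smul_apply, Measure.restrict_apply' measurableSet_Icc, smul_eq_mul, inter_comm]
  rfl

theorem isProbabilityMeasure_orbitAverage (x : X) (n : ℕ) :
    IsProbabilityMeasure (S.orbitAverage x n) := by
  refine ⟨?_⟩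
  rw [S.orbitAverage_apply x n MeasurableSet.univ]
  have h : volume (Icc (0 : ℝ) (n + 1)) = (n + 1 : ℝ≥0∞) := by
    rw [Real.volume_Icc, sub_zero]
    exact_mod_cast ENNReal.ofReal_natCast (n + 1)
  have h2 : {t ∈ Icc (0 : ℝ) (n + 1) | S.semiflow t.toNNReal x ∈ (univ : Set X)} =
      Icc (0 : ℝ) (n + 1) := by
    ext
    simp
  rw [h2, h, ENNReal.inv_mul_cancel (by simp) (by finiteness)]

theorem orbitAverage_mono_of_orbit {x : X} {n : ℕ} {A B : Set X} (hA : MeasurableSet A)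
    (hB : MeasurableSet B) (h : ∀ t, S.semiflow t x ∈ A → S.semiflow t x ∈ B) :
    S.orbitAverage x n A ≤ S.orbitAverage x n B := by
  rw [S.orbitAverage_apply x n hA, S.orbitAverage_apply x n hB]
  gcongr _ * volume ?_
  exact fun t ht => ⟨ht.1, h _ ht.2⟩

/-- A visit to A at time t > s is a visit to the preimage at time t - s; only the times in [0, s]
are lost. -/
theorem orbitAverage_le_preimage_add (x : X) (n : ℕ) (s : ℝ≥0) {A : Set X}
    (hA : MeasurableSet A) :
    S.orbitAverage x n A ≤ S.orbitAverage x n (S.semiflow s ⁻¹' A) + (n + 1 : ℝ≥0∞)⁻¹ * s := by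
  rw [S.orbitAverage_apply x n hA,
    S.orbitAverage_apply x n (S.measurable_semiflow_apply s hA), ← mul_add]
  gcongr
  set B := {t ∈ Icc (0 : ℝ) (n + 1) | S.semiflow t.toNNReal x ∈ S.semiflow s ⁻¹' A} with hB
  have hsub : {t ∈ Icc (0 : ℝ) (n + 1) | S.semiflow t.toNNReal x ∈ A} ⊆
      (fun t => t + -(s : ℝ)) ⁻¹' B ∪ Icc 0 s := by
    rintro t ⟨ht, htA⟩
    rcases le_or_gt t s with h | h
    · exact Or.inr ⟨ht.1, h⟩
    · have hs := s.2
      refine Or.inl ⟨⟨by linarith, by linarith [ht.2]⟩, ?_⟩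
      rw [mem_preimage, ← S.semiflow_add]
      convert htA using 2
      ext
      rw [NNReal.coe_add, Real.coe_toNNReal _ (by linarith), Real.coe_toNNReal _ ht.1]
      ring
  refine (measure_mono hsub).trans ((measure_union_le _ _).trans ?_)
  rw [measure_preimage_add_right]
  gcongr
  simp [Real.volume_Icc]

/-- The fraction of time spent shortly before an impulse is small. -/
theorem orbitAverage_tau1_lt_le {x : X} {δ : ℝ≥0} (hδ : 0 < δ)
    (hx : ∀ n : ℕ, ((n * δ : ℝ≥0) : ℝ≥0∞) ≤ S.tau (n + 1) x) (n : ℕ) (ε : ℝ≥0) :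
    S.orbitAverage x n {y | S.tau1 y < ε} ≤ ((δ⁻¹ + 2) * ε : ℝ≥0) := by
  rw [S.orbitAverage_apply x n (measurableSet_lt S.measurable_tau1 measurable_const)]
  -- The next impulse after a time t ≤ n + 1 has index k + 1 with `tau k x ≤ n + 1`, which forces k
  -- - 1 ≤ (n + 1) / δ when k ≥ 1.
  set M := ⌊(n + 1) / δ⌋₊ + 2 with hM
  have hsub : {t ∈ Icc (0 : ℝ) (n + 1) | S.semiflow t.toNNReal x ∈ {y | S.tau1 y < ε}} ⊆
      ⋃ k ∈ Finset.range M, Icc ((S.tau (k + 1) x).toReal - ε) (S.tau (k + 1) x).toReal := by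
    rintro t ⟨ht, hlt⟩
    obtain ⟨k, hk1, hk2⟩ := S.exists_tau1_semiflow_add t.toNNReal x
    simp only [mem_iUnion, Finset.mem_range]
    refine ⟨k, ?_, ?_⟩
    · rcases k with _ | k
      · omega
      · have h1 : ((k * δ : ℝ≥0) : ℝ≥0∞) ≤ t.toNNReal := (hx k).trans hk1
        have h2 : k * δ ≤ n + 1 := by
          have : t.toNNReal ≤ n + 1 := Real.toNNReal_le_iff_le_coe.2 (by simpa using ht.2)
          exact (ENNReal.coe_le_coe.1 h1).trans this
        have h3 : k ≤ ⌊(n + 1) / δ⌋₊ := Nat.le_floor ((le_div_iff₀ hδ).2 h2)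
        omega
    · have hfin : S.tau1 (S.semiflow t.toNNReal x) ≠ ⊤ := ne_top_of_lt hlt
      have h4 : (S.tau (k + 1) x).toReal = (S.tau1 (S.semiflow t.toNNReal x)).toReal + t := by
        rw [← hk2, ENNReal.toReal_add hfin ENNReal.coe_ne_top]
        simp [ht.1]
      have h5 : (S.tau1 (S.semiflow t.toNNReal x)).toReal < ε := by
        have := (ENNReal.toReal_lt_toReal hfin ENNReal.coe_ne_top).2 hlt
        simpa using this
      rw [h4]
      exact ⟨by linarith, le_add_of_nonneg_left ENNReal.toReal_nonneg⟩
  have hvol : volume {t ∈ Icc (0 : ℝ) (n + 1) |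
      S.semiflow t.toNNReal x ∈ {y | S.tau1 y < ε}} ≤ ((M * ε : ℝ≥0) : ℝ≥0∞) := by
    refine (measure_mono hsub).trans ((measure_biUnion_finset_le _ _).trans ?_)
    simp [Real.volume_Icc]
  have hM' : (M : ℝ≥0) ≤ (n + 1) * (δ⁻¹ + 2) := by
    have h6 : (⌊(n + 1) / δ⌋₊ : ℝ≥0) ≤ (n + 1) / δ := Nat.floor_le zero_le
    calc (M : ℝ≥0) = ⌊(n + 1) / δ⌋₊ + 2 := by simp [hM]
      _ ≤ (n + 1) / δ + (n + 1) * 2 := by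
        gcongr
        exact le_mul_of_one_le_left zero_le le_add_self
      _ = _ := by rw [div_eq_mul_inv, mul_add]
  calc _ ≤ (n + 1 : ℝ≥0∞)⁻¹ * ((M * ε : ℝ≥0) : ℝ≥0∞) := by gcongr
    _ ≤ (n + 1 : ℝ≥0∞)⁻¹ * (((n + 1) * (δ⁻¹ + 2) * ε : ℝ≥0) : ℝ≥0∞) := by gcongr
    _ = _ := by
      rw [mul_assoc, ENNReal.coe_mul, ← mul_assoc]
      push_cast
      rw [ENNReal.inv_mul_cancel (by simp) (by finiteness), one_mul]

end OrbitAverage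

/-! ### Existence of an invariant measure. -/

section Existence

variable [CompactSpace X] [MeasurableSpace X] [BorelSpace X]

/-- A weak limit of orbit averages of a point of `Ω \ D` is concentrated on `Ω \ D`, and
shifting the averages by the time `s` bounds it on open sets. -/
theorem exists_limit_orbitAverage [Nonempty X] (hτ : Continuous S.tauD)
    (hI : S.I '' {d | (d : X) ∈ S.Omega} ⊆ S.Omega \ S.D) :
    ∃ μ : Measure X, IsProbabilityMeasure μ ∧ μ (S.Omega \ S.D)ᶜ = 0 ∧
      ∀ (s : ℝ≥0) (G : Set X), IsOpen G →
        μ G ≤ μ (closure (S.semiflow s ⁻¹' closure G ∩ (S.Omega \ S.D))) := by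
  obtain ⟨x, hx⟩ := S.nonempty_Omega_diff_D hI
  have horb := S.semiflow_mem hI hx
  obtain ⟨δ, hδ0, hδ⟩ := S.exists_pos_mul_le_tau hτ hI
  let P : ℕ → ProbabilityMeasure X := fun n =>
    ⟨S.orbitAverage x n, S.isProbabilityMeasure_orbitAverage x n⟩
  obtain ⟨μ, hμ⟩ := exists_clusterPt_of_compactSpace (map P atTop)
  -- Along an ultrafilter the averages of every set converge, so portmanteau bounds can be chained
  -- without further subsequences.
  obtain ⟨L, hL, hlim⟩ := mapClusterPt_iff_ultrafilter.1 hμ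
  have hconv : ∀ A : Set X, ∃ c, Tendsto (fun n => S.orbitAverage x n A) L (𝓝 c) := fun A =>
    ⟨_, (L.map fun n => S.orbitAverage x n A).le_nhds_lim⟩
  have hclosed : ∀ {F c}, IsClosed F → Tendsto (fun n => S.orbitAverage x n F) L (𝓝 c) →
      c ≤ (μ : Measure X) F := fun {F c} hF hc => by
    have := ProbabilityMeasure.limsup_measure_closed_le_of_tendsto hlim hF
    exact hc.limsup_eq.symm.le.trans this
  have hopen : ∀ {G c}, IsOpen G → Tendsto (fun n => S.orbitAverage x n G) L (𝓝 c) →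
      (μ : Measure X) G ≤ c := fun {G c} hG hc => by
    have := ProbabilityMeasure.le_liminf_measure_open_of_tendsto hlim hG
    exact this.trans hc.liminf_eq.le
  have hΩ : (μ : Measure X) S.Omegaᶜ = 0 := by
    rw [prob_compl_eq_zero_iff S.isClosed_Omega.measurableSet]
    refine le_antisymm prob_le_one (hclosed S.isClosed_Omega ?_)
    refine tendsto_const_nhds.congr fun n => ?_
    have := S.isProbabilityMeasure_orbitAverage x n
    refine le_antisymm ?_ prob_le_one
    rw [← measure_univ (μ := S.orbitAverage x n)]
    exact S.orbitAverage_mono_of_orbit MeasurableSet.univ S.isClosed_Omega.measurableSet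
      fun t _ => (horb t).1
  have hsmall : ∀ ε : ℝ≥0, 0 < ε → (μ : Measure X) S.D ≤ ((δ⁻¹ + 2) * ε : ℝ≥0) := by
    intro ε hε
    have hopenΩ : IsOpen {y : S.Omega | S.tauD y < ε} := isOpen_Iio.preimage hτ
    obtain ⟨V, hV, hVeq⟩ := isOpen_induced_iff.1 hopenΩ
    have hV' : ∀ y (hy : y ∈ S.Omega), y ∈ V ↔ S.tauD ⟨y, hy⟩ < ε := fun y hy =>
      Set.ext_iff.1 hVeq ⟨y, hy⟩
    have hDV : S.D ⊆ V ∪ S.Omegaᶜ := by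
      intro y hy
      by_cases hyΩ : y ∈ S.Omega
      · refine Or.inl ((hV' y hyΩ).2 ?_)
        simpa [tauD, hy] using hε
      · exact Or.inr hyΩ
    obtain ⟨c, hc⟩ := hconv V
    calc (μ : Measure X) S.D ≤ (μ : Measure X) V + (μ : Measure X) S.Omegaᶜ :=
          (measure_mono hDV).trans (measure_union_le _ _)
      _ ≤ c := by rw [hΩ, add_zero]; exact hopen hV hc
      _ ≤ _ := by
        refine le_of_tendsto' hc fun n => ?_
        refine le_trans ?_ (S.orbitAverage_tau1_lt_le hδ0 (hδ x hx) n ε)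
        refine S.orbitAverage_mono_of_orbit hV.measurableSet
          (measurableSet_lt S.measurable_tau1 measurable_const) fun t ht => ?_
        have := (hV' _ (horb t).1).1 ht
        simpa [tauD, (horb t).2] using this
  have hD : (μ : Measure X) S.D = 0 := by
    refine le_antisymm (ENNReal.le_of_forall_pos_le_add fun η hη _ => ?_) zero_le
    rw [zero_add]
    refine (hsmall (η / (δ⁻¹ + 2)) (by positivity)).trans ?_
    rw [mul_div_cancel₀ _ (by positivity)]
  refine ⟨μ, inferInstance, ?_, fun s G hG => ?_⟩
  · refine measure_mono_null (t := S.Omegaᶜ ∪ S.D) (fun y hy => ?_)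
      (measure_union_null hΩ hD)
    by_cases h : y ∈ S.Omega
    · exact Or.inr (not_not.1 fun h' => hy ⟨h, h'⟩)
    · exact Or.inl h
  · obtain ⟨g, hg⟩ := hconv G
    obtain ⟨c, hc⟩ := hconv (closure (S.semiflow s ⁻¹' closure G ∩ (S.Omega \ S.D)))
    refine (hopen hG hg).trans (le_trans ?_ (hclosed isClosed_closure hc))
    have hs : Tendsto (fun n : ℕ => (n + 1 : ℝ≥0∞)⁻¹ * s) L (𝓝 0) := by
      have h1 : Tendsto (fun n : ℕ => (n + 1 : ℝ≥0∞)⁻¹) atTop (𝓝 0) := by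
        refine (ENNReal.tendsto_inv_nat_nhds_zero.comp (tendsto_add_atTop_nat 1)).congr
          fun n => ?_
        simp
      simpa using ENNReal.Tendsto.mul_const (b := (s : ℝ≥0∞)) (h1.mono_left hL) (by simp)
    have hsum := hc.add hs
    rw [add_zero] at hsum
    refine le_of_tendsto_of_tendsto' hg hsum fun n => ?_
    refine (S.orbitAverage_le_preimage_add x n s hG.measurableSet).trans ?_
    gcongr ?_ + _
    refine S.orbitAverage_mono_of_orbit (S.measurable_semiflow_apply s hG.measurableSet)
      isClosed_closure.measurableSet fun t ht => ?_
    have ht' : S.semiflow t x ∈ S.semiflow s ⁻¹' closure G := subset_closure ht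
    exact subset_closure ⟨ht', horb t⟩

theorem exists_isInvariantProbability [Nonempty X] (hτ : Continuous S.tauD)
    (hI : S.I '' {d | (d : X) ∈ S.Omega} ⊆ S.Omega \ S.D) :
    ∃ μ : Measure X, IsInvariantProbability S.semiflow μ := by
  obtain ⟨μ, hμ, hW, hG⟩ := S.exists_limit_orbitAverage hτ hI
  -- Level sets are disjoint, so each n contributes countably many times. Time 0 belongs to B
  -- because `tau 0` vanishes identically.
  let B : Set ℝ≥0 := ⋃ n, {t : ℝ≥0 | 0 < μ {y | S.tau n y = t}}
  have hB : B.Countable := countable_iUnion fun n =>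
    (Measure.countable_meas_level_set_pos (μ := μ) (S.measurable_tau n)).preimage
      ENNReal.coe_injective
  have hgood : ∀ s ∉ B, μ.map (S.semiflow s) = μ := by
    intro s hs
    have hm := S.measurable_semiflow_apply s
    have := Measure.isProbabilityMeasure_map (μ := μ) hm.aemeasurable
    refine (eq_of_forall_isOpen_le_closure fun G hGo => (hG s G hGo).trans ?_).symm
    rw [Measure.map_apply hm isClosed_closure.measurableSet]
    have hbad : ∀ n, μ {y | S.tau n y = s} = 0 := fun n => by
      by_contra h
      exact hs (mem_iUnion.2 ⟨n, pos_iff_ne_zero.2 h⟩)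
    -- Continuity at the non-exceptional points of `Ω \ D` makes the outer closure harmless up to a
    -- null set.
    have hsub : closure (S.semiflow s ⁻¹' closure G ∩ (S.Omega \ S.D)) ⊆
        S.semiflow s ⁻¹' closure G ∪ ((S.Omega \ S.D)ᶜ ∪ ⋃ n, {y | S.tau n y = s}) := by
      intro y hy
      by_cases hyW : y ∈ S.Omega \ S.D
      · by_cases hyt : ∃ n, S.tau n y = s
        · exact Or.inr (Or.inr (mem_iUnion.2 hyt))
        · push Not at hyt
          have h1 := (S.continuousWithinAt_semiflow hτ hI hyW hyt).mono
            (inter_subset_right (s := S.semiflow s ⁻¹' closure G))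
          have h2 := h1.mem_closure hy (t := closure G) fun z hz => hz.1
          rw [closure_closure] at h2
          exact Or.inl h2
      · exact Or.inr (Or.inl hyW)
    refine (measure_mono hsub).trans ((measure_union_le _ _).trans ?_)
    rw [measure_union_null hW (measure_iUnion_null hbad), add_zero]
  have hall : ∀ s, μ.map (S.semiflow s) = μ := by
    intro s
    rcases eq_or_lt_of_le (zero_le : 0 ≤ s) with rfl | h0
    · have : S.semiflow 0 = id := funext S.semiflow_zero
      rw [this, Measure.map_id]
    · have hc : {a : ℝ≥0 | a ∈ Iic s ∧ s - a ∈ B}.Countable := by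
        refine (hB.image fun b => s - b).mono ?_
        rintro a ⟨ha, hb⟩
        exact ⟨s - a, hb, tsub_tsub_cancel_of_le ha⟩
      have hunc : ¬ (Iic s).Countable := by
        intro h
        have h1 : (Icc (0 : ℝ) s).Countable := by
          refine (h.image fun a : ℝ≥0 => (a : ℝ)).mono fun t ht => ?_
          exact ⟨⟨t, ht.1⟩, by exact_mod_cast ht.2, rfl⟩
        exact (Cardinal.Real.Icc_countable_iff.1 h1).not_gt (by exact_mod_cast h0)
      -- [0, s] is uncountable, so s splits as a + (s - a) with both times outside B.
      obtain ⟨a, ha, hab⟩ : ∃ a ∈ Iic s, a ∉ B ∧ s - a ∉ B := by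
        by_contra! h
        refine hunc ((hB.union hc).mono fun a ha => ?_)
        by_cases haB : a ∈ B
        · exact Or.inl haB
        · exact Or.inr ⟨ha, h a ha haB⟩
      have hcomp : S.semiflow s = S.semiflow (s - a) ∘ S.semiflow a := by
        ext y
        rw [Function.comp_apply, ← S.semiflow_add, tsub_add_cancel_of_le ha]
      rw [hcomp, ← Measure.map_map (S.measurable_semiflow_apply _)
        (S.measurable_semiflow_apply _), hgood a hab.1, hgood _ hab.2]
  refine ⟨μ, hμ, S.measurable_semiflow, fun t A hA => ?_⟩
  rw [← Measure.map_apply (S.measurable_semiflow_apply t) hA, hall t]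

end Existence

end ImpulsiveSystem

end Impulsive

theorem theoremA {X : Type*} [MetricSpace X] [CompactSpace X] [Nonempty X]
    [MeasurableSpace X] [BorelSpace X] (S : Impulsive.ImpulsiveSystem X)
    (hτ : Continuous S.tauD)
    (hI : S.I '' {d | (d : X) ∈ S.Omega} ⊆ S.Omega \ S.D) :
    (∃ μ : Measure X, Impulsive.IsInvariantProbability S.semiflow μ) ∧
      ∀ μ : Measure X, Impulsive.IsInvariantProbability S.semiflow μ →
        μ.support ⊆ S.Omega ∧ μ S.D = 0 :=
  ⟨S.exists_isInvariantProbability hτ hI,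
    fun _ hμ => ⟨S.support_subset_Omega hμ, S.measure_D_eq_zero hμ⟩⟩
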